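/- Put $A=\begin{pmatrix}1&1\\1&2\end{pmatrix}$ and $B=\begin{pmatrix}2&1\\1&1\end{pmatrix}$. A path in $\mathbb{N}^2$ starting at $(0,0)$ is a finite sequence of unit steps, each either horizontal (adding $(1,0)$) or vertical (adding $(0,1)$). The $m$-value $m(\mathbf w)$ of a path $\mathbf w$ is the top-right entry of the matrix product obtained by replacing, in order, each horizontal step by $A$ and each vertical step by $B$. The Farey tree is the infinite binary tree of triples of fractions with root $\left(\frac01,\frac12,\frac11\right)$ in which a node $\left(\frac ab,\frac{c}{d},\frac ef\right)$ has left child $\left(\frac ab,\frac{a+c}{b+d},\frac cd\right)$ and right child $\left(\frac cd,\frac{c+e}{d+f},\frac ef\right)$. The Markov tree is the infinite binary tree of solutions of $x^2+y^2+z^2=3xyz$ with root $(1,5,2)$ in which a node $(x,y,z)$ has left child $(x,3xy-z,y)$ and right child $(y,3yz-x,z)$. For coprime integers $0\le p<q$, let $m_{p/q}$ be the number standing in the Markov tree at a place (node and position in the triple) where $\frac pq$ stands in the Farey tree. Theorem. For all coprime integers $0\le p<q$, the number $m_{p/q}$ is well defined (such a place exists, and all such places carry the same number), and $$m_{p/q}=\min_{\mathbf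 w\text{ a path from }(0,0)\text{ to }(q,p)} m(\mathbf w).$$ -/

import Mathlib

/-- The two letters: `a` is a horizontal unit step, `b` a vertical unit step. -/
inductive Letter where
  | a
  | b

/-- The displacement of a letter in `ℕ × ℕ`. -/
def Letter.step : Letter → ℕ × ℕ
  | .a => (1, 0)
  | .b => (0, 1)

/-- The matrix of a letter. -/
def Letter.matrix : Letter → Matrix (Fin 2) (Fin 2) ℤ
  | .a => !![1, 1; 1, 2]
  | .b => !![2, 1; 1, 1]

/-- The endpoint of the lattice path that starts at `(0, 0)` and follows the word `w`. -/
def pathEnd (w : List Letter) : ℕ × ℕ := (w.map Letter.step).sum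

/-- The `m`-value of a word: the top-right entry of the product, in order, of the matrices of its
letters. -/
def mValue (w : List Letter) : ℤ := (w.map Letter.matrix).prod 0 1

/-- A move from a node of a binary tree to one of its two children. -/
inductive Move where
  | left
  | right

/-- The Farey tree. The fraction `x / y` is represented by the pair `(x, y)`, so that the mediant
of two fractions is the sum of the pairs. A node is addressed by the list of moves that lead to it
from the root, the most recent move being the head of the list. -/
def fareyTree : List Move → Fin 3 → ℕ × ℕ
  | [] => ![(0, 1), (1, 2), (1, 1)]
  | .left :: s => ![fareyTree s 0, fareyTree s 0 + fareyTree s 1, fareyTree s 1]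
  | .right :: s => ![fareyTree s 1, fareyTree s 1 + fareyTree s 2, fareyTree s 2]

/-- The Markov tree, of the Markov triples `(x, y, z)` with pairwise distinct entries and maximum
`y`; the children of `(x, y, z)` are `(x, 3xy - z, y)` and `(y, 3yz - x, z)`. Addresses are as for
the Farey tree. -/
def markovTree : List Move → Fin 3 → ℤ
  | [] => ![1, 5, 2]
  | .left :: s =>
    ![markovTree s 0, 3 * markovTree s 0 * markovTree s 1 - markovTree s 2, markovTree s 1]
  | .right :: s =>
    ![markovTree s 1, 3 * markovTree s 1 * markovTree s 2 - markovTree s 0, markovTree s 2]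

/-- `k` stands in the Markov tree at a place at which the fraction `p / q` (in lowest terms) stands
in the Farey tree. -/
def IsMarkovNumberAt (p q : ℕ) (k : ℤ) : Prop :=
  ∃ (s : List Move) (i : Fin 3), fareyTree s i = (p, q) ∧ markovTree s i = k

/-- The Markov number `m_{p/q}`: the number that stands in the Markov tree where `p / q` stands in
the Farey tree. -/
noncomputable def markovNumber (p q : ℕ) : ℤ := Classical.epsilon (IsMarkovNumberAt p q)

/-!
The theorem holds because a path to a primitive lattice point `(q, p)` which is not the lower
Christoffel path can always be improved by exchanging two consecutive letters.

Write `D x y` for `x₀₀ y₁₁ - x₀₁ y₀₁`, computed from the matrices of the words `x` and `y`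
(`swapGain`). Since `AB - BA = -2J` with `J = !![0, 1; -1, 0]`, the `m`-values of `x ba y` and
`x ab y` differ by `2 D x y` (`mValue_swap`). As `A J A = B J B = J`, a letter which ends `x` and starts `y` can be
cancelled, so the sign of `D x y` is decided where the reversal of `x` and `y` first differ.

Measure the position of a path by its height `p · #a - q · #b`, which vanishes at both ends. The
lower Christoffel path is the only one whose heights all lie in `[0, p + q)`
(`IsChristoffel.eq_of_pathEnd_eq`). If the minimal height is negative, it is attained at a corner
`x b | a y`. As long as the reversal of `x` and `y` agree, the heights reached along them are
symmetric about a fixed value, and minimality forces `D x y > 0`: exchanging `b` and `a` lowers the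
`m`-value. A maximal height which is at least `p + q` is treated in the same way. Coprimality enters
by making the heights of a path distinct, apart from its two ends, which excludes ties.

Concatenation along the Farey tree, starting from the words `a`, `aab`, `ab`, yields the Christoffel
words, and since their matrices have determinant `1` and a trace which is three times the top-right
entry, the theorem of Cayley and Hamilton turns concatenation into the rule of the Markov tree. So
every entry of the Markov tree is the minimum for the fraction at its place; this also shows that
it depends on the fraction only. That every fraction occurs is the usual descent in the Stern–Brocot
tree.
-/

/-! ### Words, matrices and endpoints -/

/-- The product, in order, of the matrices of the letters of a word. -/
def wordMatrix (w : List Letter) : Matrix (Fin 2) (Fin 2) ℤ := (w.map Letter.matrix).prod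

lemma mValue_eq_wordMatrix (w : List Letter) : mValue w = wordMatrix w 0 1 := rfl

@[simp] lemma wordMatrix_nil : wordMatrix [] = 1 := rfl

lemma wordMatrix_cons (l : Letter) (w : List Letter) :
    wordMatrix (l :: w) = l.matrix * wordMatrix w := by
  simp [wordMatrix]

lemma wordMatrix_append (v w : List Letter) :
    wordMatrix (v ++ w) = wordMatrix v * wordMatrix w := by
  simp [wordMatrix]

lemma wordMatrix_det (w : List Letter) : (wordMatrix w).det = 1 := by
  induction w with
  | nil => simp
  | cons l w ih =>
    rw [wordMatrix_cons, Matrix.det_mul, ih]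
    cases l <;> simp [Letter.matrix, Matrix.det_fin_two]

lemma wordMatrix_entries_nonneg (w : List Letter) :
    0 < wordMatrix w 0 0 ∧ 0 ≤ wordMatrix w 0 1 ∧
      0 ≤ wordMatrix w 1 0 ∧ 0 < wordMatrix w 1 1 := by
  induction w with
  | nil => simp
  | cons l w ih =>
    rw [wordMatrix_cons]
    cases l <;> simp [Letter.matrix, Matrix.mul_apply, Fin.sum_univ_two] <;> omega

lemma mValue_pos {w : List Letter} (hw : w ≠ []) : 0 < mValue w := by
  cases w with
  | nil => exact absurd rfl hw
  | cons l w =>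
    obtain ⟨h1, h2, h3, h4⟩ := wordMatrix_entries_nonneg w
    rw [mValue_eq_wordMatrix, wordMatrix_cons]
    cases l <;> simp [Letter.matrix, Matrix.mul_apply, Fin.sum_univ_two] <;> omega

lemma mValue_nonneg (w : List Letter) : 0 ≤ mValue w :=
  (wordMatrix_entries_nonneg w).2.1

@[simp] lemma pathEnd_nil : pathEnd [] = 0 := rfl

lemma pathEnd_cons (l : Letter) (w : List Letter) : pathEnd (l :: w) = l.step + pathEnd w := by
  simp [pathEnd]

lemma pathEnd_append (v w : List Letter) : pathEnd (v ++ w) = pathEnd v + pathEnd w := by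
  simp [pathEnd]

lemma pathEnd_reverse (w : List Letter) : pathEnd w.reverse = pathEnd w := by
  simp [pathEnd, List.sum_reverse]

lemma eq_nil_of_pathEnd_eq_zero {w : List Letter} (h : pathEnd w = 0) : w = [] := by
  cases w with
  | nil => rfl
  | cons l w =>
    rw [pathEnd_cons, Prod.ext_iff] at h
    cases l <;> simp [Letter.step] at h

lemma pathEnd_swap (x y : List Letter) :
    pathEnd (x ++ .a :: .b :: y) = pathEnd (x ++ .b :: .a :: y) := by
  simp only [pathEnd_append, pathEnd_cons]
  abel

/-! ### The effect of exchanging two letters -/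

/-- Half of the amount by which the `m`-value of `x ba y` exceeds that of `x ab y`. -/
def swapGain (x y : List Letter) : ℤ :=
  wordMatrix x 0 0 * wordMatrix y 1 1 - wordMatrix x 0 1 * wordMatrix y 0 1

lemma mValue_swap (x y : List Letter) :
    mValue (x ++ .b :: .a :: y) = mValue (x ++ .a :: .b :: y) + 2 * swapGain x y := by
  simp only [mValue_eq_wordMatrix, swapGain, wordMatrix_append, wordMatrix_cons, Letter.matrix,
    Matrix.mul_apply, Fin.sum_univ_two]
  simp
  ring

lemma swapGain_cancel (x y : List Letter) (l : Letter) :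
    swapGain (x ++ [l]) (l :: y) = swapGain x y := by
  cases l <;>
  · simp only [swapGain, wordMatrix_append, wordMatrix_cons, wordMatrix_nil, mul_one,
      Letter.matrix, Matrix.mul_apply, Fin.sum_univ_two]
    simp
    ring

lemma swapGain_cancel_reverse (x u y : List Letter) :
    swapGain (x ++ u.reverse) (u ++ y) = swapGain x y := by
  induction u generalizing x with
  | nil => simp
  | cons l u ih =>
    rw [List.reverse_cons, ← List.append_assoc, List.cons_append, swapGain_cancel, ih]

lemma swapGain_nil_left_pos (y : List Letter) : 0 < swapGain [] y := by
  simpa [swapGain] using (wordMatrix_entries_nonneg y).2.2.2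

lemma swapGain_nil_right_pos (x : List Letter) : 0 < swapGain x [] := by
  simpa [swapGain] using (wordMatrix_entries_nonneg x).1

lemma swapGain_b_a_pos (x y : List Letter) : 0 < swapGain (x ++ [.b]) (.a :: y) := by
  obtain ⟨h1, h2, -, -⟩ := wordMatrix_entries_nonneg x
  obtain ⟨-, k2, -, k4⟩ := wordMatrix_entries_nonneg y
  simp only [swapGain, wordMatrix_append, wordMatrix_cons, wordMatrix_nil, mul_one,
    Letter.matrix, Matrix.mul_apply, Fin.sum_univ_two]
  simp
  nlinarith [mul_pos h1 k4, mul_nonneg h1.le k2, mul_nonneg h2 k4.le]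

/-- The exception is genuine: exchanging the middle letters of `aabb` does not change the
`m`-value. -/
lemma swapGain_a_b_neg (x y : List Letter) (hxy : ¬ (x = [] ∧ y = [])) :
    swapGain (x ++ [.a]) (.b :: y) < 0 := by
  obtain ⟨h1, h2, -, -⟩ := wordMatrix_entries_nonneg x
  obtain ⟨-, k2, -, k4⟩ := wordMatrix_entries_nonneg y
  have key : swapGain (x ++ [.a]) (.b :: y) =
      -(wordMatrix x 0 0 * wordMatrix y 0 1 + 3 * (wordMatrix x 0 1 * wordMatrix y 0 1)
        + wordMatrix x 0 1 * wordMatrix y 1 1) := by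
    simp only [swapGain, wordMatrix_append, wordMatrix_cons, wordMatrix_nil, mul_one,
      Letter.matrix, Matrix.mul_apply, Fin.sum_univ_two]
    simp
    ring
  rw [key]
  by_cases hx : x = []
  · have hy : 0 < wordMatrix y 0 1 := mValue_pos fun h => hxy ⟨hx, h⟩
    nlinarith [mul_pos h1 hy, mul_nonneg h2 k2, mul_nonneg h2 k4.le]
  · have hx : 0 < wordMatrix x 0 1 := mValue_pos hx
    nlinarith [mul_pos hx k4, mul_nonneg h2 k2, mul_nonneg h1.le k2]

/-- Comparison of the reversal of `x` with `y`: either one is a prefix of the other, or they first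
differ after a common prefix `u`. -/
lemma reverse_compare (x y : List Letter) :
    (∃ u y', x = u.reverse ∧ y = u ++ y') ∨ (∃ x', x = x' ++ y.reverse) ∨
    (∃ u x' y', x = x' ++ .b :: u.reverse ∧ y = u ++ .a :: y') ∨
    (∃ u x' y', x = x' ++ .a :: u.reverse ∧ y = u ++ .b :: y') := by
  induction y generalizing x with
  | nil => exact .inr (.inl ⟨x, by simp⟩)
  | cons l y ih =>
    rcases List.eq_nil_or_concat x with rfl | ⟨x, k, rfl⟩
    · exact .inl ⟨[], l :: y, by simp⟩
    · by_cases hkl : k = l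
      · subst hkl
        rcases ih x with ⟨u, y', rfl, rfl⟩ | ⟨x', rfl⟩ | ⟨u, x', y', rfl, rfl⟩ |
          ⟨u, x', y', rfl, rfl⟩
        · exact .inl ⟨k :: u, y', by simp⟩
        · exact .inr (.inl ⟨x', by simp⟩)
        · exact .inr (.inr (.inl ⟨k :: u, x', y', by simp⟩))
        · exact .inr (.inr (.inr ⟨k :: u, x', y', by simp⟩))
      · cases k <;> cases l
        · exact absurd rfl hkl
        · exact .inr (.inr (.inr ⟨[], x, y, by simp⟩))
        · exact .inr (.inr (.inl ⟨[], x, y, by simp⟩))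
        · exact absurd rfl hkl

/-! ### Heights and Christoffel words -/

/-- The height `p i - q j` of the endpoint `(i, j)` of a path, that is, its signed distance, up to
a scalar, from the line through `(0, 0)` and `(q, p)`; it is positive below the line. -/
def height (p q : ℕ) (w : List Letter) : ℤ := p * (pathEnd w).1 - q * (pathEnd w).2

section Height

variable {p q : ℕ}

@[simp] lemma height_nil : height p q [] = 0 := by simp [height]

@[simp] lemma height_append (v w : List Letter) :
    height p q (v ++ w) = height p q v + height p q w := by
  simp only [height, pathEnd_append, Prod.fst_add, Prod.snd_add]
  push_cast
  ring

@[simp] lemma height_cons_a (w : List Letter) : height p q (.a :: w) = p + height p q w := by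
  simp only [height, pathEnd_cons, Prod.fst_add, Prod.snd_add, Letter.step]
  push_cast
  ring

@[simp] lemma height_cons_b (w : List Letter) : height p q (.b :: w) = -q + height p q w := by
  simp only [height, pathEnd_cons, Prod.fst_add, Prod.snd_add, Letter.step]
  push_cast
  ring

@[simp] lemma height_reverse (w : List Letter) : height p q w.reverse = height p q w := by
  simp [height, pathEnd_reverse]

lemma height_eq_zero {w : List Letter} (hw : pathEnd w = (q, p)) : height p q w = 0 := by
  simp only [height, hw]
  ring

/-- The vertices of a path to a primitive vector `(q, p)` have distinct heights, apart from the two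
ends of the path. -/
lemma eq_nil_or_of_height_eq_zero (hq : 0 < q) (hpq : p.Coprime q) {s m t : List Letter}
    (hw : pathEnd (s ++ m ++ t) = (q, p)) (hm : height p q m = 0) :
    m = [] ∨ (s = [] ∧ t = []) := by
  rw [pathEnd_append, pathEnd_append, Prod.ext_iff] at hw
  obtain ⟨h1, h2⟩ := hw
  simp only [Prod.fst_add, Prod.snd_add] at h1 h2
  have hm' : p * (pathEnd m).1 = q * (pathEnd m).2 := by
    rw [height] at hm
    zify
    linarith
  obtain ⟨k, hk⟩ : q ∣ (pathEnd m).1 :=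
    hpq.symm.dvd_of_dvd_mul_left (Dvd.intro _ hm'.symm)
  have hk2 : (pathEnd m).2 = p * k := by
    rw [hk] at hm'
    exact Nat.eq_of_mul_eq_mul_left hq (by linarith)
  rcases Nat.eq_zero_or_pos k with rfl | hk0
  · left
    exact eq_nil_of_pathEnd_eq_zero (Prod.ext (by simpa using hk) (by simpa using hk2))
  · right
    have e1 : q ≤ (pathEnd m).1 := hk ▸ Nat.le_mul_of_pos_right _ hk0
    have e2 : p ≤ (pathEnd m).2 := hk2 ▸ Nat.le_mul_of_pos_right _ hk0
    constructor <;> apply eq_nil_of_pathEnd_eq_zero <;> apply Prod.ext <;>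
      simp only [Prod.fst_zero, Prod.snd_zero] <;> omega

/-- All vertices of the path have heights in `[0, p + q)`. For a path to a primitive vector `(q, p)`
this means that it is the lower Christoffel path of slope `p / q`. -/
def IsChristoffel (p q : ℕ) (w : List Letter) : Prop :=
  ∀ x y, x ++ y = w → 0 ≤ height p q x ∧ height p q x < p + q

/-- Paths which start at the same height `k` and stay in `[0, p + q)` never diverge: at each height
only one of the two letters is possible. -/
lemma eq_of_height_mem {v w : List Letter} (k : ℤ)
    (hv : ∀ x y, x ++ y = v → 0 ≤ k + height p q x ∧ k + height p q x < p + q)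
    (hw : ∀ x y, x ++ y = w → 0 ≤ k + height p q x ∧ k + height p q x < p + q)
    (h : pathEnd v = pathEnd w) : v = w := by
  induction v generalizing w k with
  | nil => exact (eq_nil_of_pathEnd_eq_zero h.symm).symm
  | cons l v ih =>
    cases w with
    | nil => exact eq_nil_of_pathEnd_eq_zero h
    | cons l' w =>
      have hl : l = l' := by
        have h1 := hv [l] v rfl
        have h2 := hw [l'] w rfl
        cases l <;> cases l' <;> simp at h1 h2 ⊢ <;> omega
      subst hl
      rw [pathEnd_cons, pathEnd_cons] at h
      congr 1
      refine ih (k + height p q [l]) (fun x y hxy => ?_) (fun x y hxy => ?_) (add_left_cancel h)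
      · simpa [add_assoc, ← height_append] using hv (l :: x) y (by simp [hxy])
      · simpa [add_assoc, ← height_append] using hw (l :: x) y (by simp [hxy])

lemma IsChristoffel.eq_of_pathEnd_eq {v w : List Letter} (hv : IsChristoffel p q v)
    (hw : IsChristoffel p q w) (h : pathEnd v = pathEnd w) : v = w :=
  eq_of_height_mem 0 (by simpa only [zero_add]) (by simpa only [zero_add]) h

lemma exists_prefix_forall_le (f : List Letter → ℤ) (w : List Letter) :
    ∃ s t, s ++ t = w ∧ ∀ x y, x ++ y = w → f s ≤ f x := by
  obtain ⟨i, -, hi⟩ := Finset.exists_min_image (Finset.range (w.length + 1))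
    (fun i => f (w.take i)) ⟨0, by simp⟩
  refine ⟨w.take i, w.drop i, List.take_append_drop i w, fun x y hxy => ?_⟩
  have := hi x.length (by simp [← hxy])
  simpa [← hxy] using this

/-! ### Every other path can be improved -/

lemma exists_mValue_lt_of_height_neg (hq : 0 < q) (hpq : p.Coprime q) {w : List Letter}
    (hw : pathEnd w = (q, p)) (hneg : ∃ x y, x ++ y = w ∧ height p q x < 0) :
    ∃ w', pathEnd w' = (q, p) ∧ mValue w' < mValue w := by
  obtain ⟨s, t, rfl, hmin⟩ := exists_prefix_forall_le (height p q) w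
  have hs : height p q s < 0 := by
    obtain ⟨x, y, hxy, hx⟩ := hneg
    exact (hmin x y hxy).trans_lt hx
  have h0 := height_eq_zero hw
  obtain ⟨s', rfl⟩ : ∃ s', s = s' ++ [.b] := by
    rcases List.eq_nil_or_concat s with rfl | ⟨s', l, rfl⟩
    · simp at hs
    cases l
    · have h1 := hmin s' (.a :: t) (by simp)
      simp at h1 hs h0
      rcases eq_nil_or_of_height_eq_zero hq hpq (s := s') (m := [.a]) (t := t)
        (by simpa using hw) (by simp; omega) with h | ⟨rfl, rfl⟩
      · simp at h
      · simp at hs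
        omega
    · exact ⟨s', by simp⟩
  obtain ⟨t', rfl⟩ : ∃ t', t = .a :: t' := by
    rcases t with _ | ⟨_ | _, t'⟩
    · simp at h0 hs
      omega
    · exact ⟨t', rfl⟩
    · have := hmin (s' ++ [.b, .b]) t' (by simp)
      simp at this
      omega
  suffices hgain : 0 < swapGain s' t' by
    refine ⟨s' ++ .a :: .b :: t', by rw [pathEnd_swap]; simpa using hw, ?_⟩
    have := mValue_swap s' t'
    simp only [List.append_assoc, List.singleton_append]
    omega
  rcases reverse_compare s' t' with ⟨u, y', rfl, rfl⟩ | ⟨x', rfl⟩ |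
    ⟨u, x', y', rfl, rfl⟩ | ⟨u, x', y', rfl, rfl⟩
  · have := swapGain_cancel_reverse [] u y'
    rw [List.nil_append] at this
    rw [this]
    exact swapGain_nil_left_pos y'
  · have := swapGain_cancel_reverse x' t' []
    rw [List.append_nil] at this
    rw [this]
    exact swapGain_nil_right_pos x'
  · have := swapGain_cancel_reverse (x' ++ [.b]) u (.a :: y')
    simp only [List.append_assoc, List.singleton_append] at this
    rw [this]
    exact swapGain_b_a_pos x' y'
  · -- The vertices before `a u.reverse ba` and after `ba u b` have the minimum as mean
    -- height.
    have h1 := hmin x' (.a :: u.reverse ++ [.b] ++ .a :: (u ++ .b :: y')) (by simp)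
    have h2 := hmin (x' ++ .a :: u.reverse ++ [.b] ++ .a :: (u ++ [.b])) y' (by simp)
    simp at h1 h2
    rcases eq_nil_or_of_height_eq_zero hq hpq (s := x' ++ .a :: u.reverse ++ [.b])
      (m := .a :: (u ++ [.b])) (t := y') (by simpa using hw) (by simp; omega) with h | ⟨h, -⟩ <;>
      simp at h

lemma exists_mValue_lt_of_le_height (hq : 0 < q) (hpq : p.Coprime q) {w : List Letter}
    (hw : pathEnd w = (q, p)) (hbig : ∃ x y, x ++ y = w ∧ (p + q : ℤ) ≤ height p q x) :
    ∃ w', pathEnd w' = (q, p) ∧ mValue w' < mValue w := by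
  obtain ⟨s, t, rfl, hmax⟩ := exists_prefix_forall_le (fun x => -height p q x) w
  simp only [neg_le_neg_iff] at hmax
  have hs : (p + q : ℤ) ≤ height p q s := by
    obtain ⟨x, y, hxy, hx⟩ := hbig
    exact hx.trans (hmax x y hxy)
  have h0 := height_eq_zero hw
  obtain ⟨s', rfl⟩ : ∃ s', s = s' ++ [.a] := by
    rcases List.eq_nil_or_concat s with rfl | ⟨s', l, rfl⟩
    · simp at hs
      omega
    cases l
    · exact ⟨s', by simp⟩
    · have := hmax s' (.b :: t) (by simp)
      simp at this
      omega
  obtain ⟨t', rfl⟩ : ∃ t', t = .b :: t' := by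
    rcases t with _ | ⟨_ | _, t'⟩
    · simp at h0 hs
      omega
    · have := hmax (s' ++ [.a, .a]) t' (by simp)
      simp at this
      rcases eq_nil_or_of_height_eq_zero hq hpq (s := s' ++ [.a]) (m := [.a]) (t := t')
        (by simpa using hw) (by simp; omega) with h | ⟨h, -⟩ <;> simp at h
    · exact ⟨t', rfl⟩
  suffices hgain : swapGain s' t' < 0 by
    refine ⟨s' ++ .b :: .a :: t', by rw [← pathEnd_swap]; simpa using hw, ?_⟩
    have := mValue_swap s' t'
    simp only [List.append_assoc, List.singleton_append]
    omega
  -- In the first three cases, reflection in the middle of the corner yields a vertex whose height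
  -- is again the maximum.
  rcases reverse_compare s' t' with ⟨u, y', rfl, rfl⟩ | ⟨x', rfl⟩ |
    ⟨u, x', y', rfl, rfl⟩ | ⟨u, x', y', rfl, rfl⟩
  · have h1 := hmax (u.reverse ++ [.a] ++ .b :: u) y' (by simp)
    simp at h1 hs
    rcases eq_nil_or_of_height_eq_zero hq hpq (s := u.reverse ++ [.a]) (m := .b :: u) (t := y')
      (by simpa using hw) (by simp; omega) with h | ⟨h, -⟩ <;> simp at h
  · have h1 := hmax x' (t'.reverse ++ [.a] ++ .b :: t') (by simp)
    simp at h1 hs h0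
    rcases eq_nil_or_of_height_eq_zero hq hpq (s := x') (m := t'.reverse ++ [.a]) (t := .b :: t')
      (by simpa using hw) (by simp; omega) with h | ⟨-, h⟩ <;> simp at h
  · have h1 := hmax x' (.b :: u.reverse ++ [.a] ++ .b :: (u ++ .a :: y')) (by simp)
    have h2 := hmax (x' ++ .b :: u.reverse ++ [.a] ++ .b :: (u ++ [.a])) y' (by simp)
    simp at h1 h2
    rcases eq_nil_or_of_height_eq_zero hq hpq (s := x' ++ .b :: u.reverse ++ [.a])
      (m := .b :: (u ++ [.a])) (t := y') (by simpa using hw) (by simp; omega) with h | ⟨h, -⟩ <;>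
      simp at h
  · have := swapGain_cancel_reverse (x' ++ [.a]) u (.b :: y')
    simp only [List.append_assoc, List.singleton_append] at this
    rw [this]
    refine swapGain_a_b_neg x' y' ?_
    rintro ⟨rfl, rfl⟩
    -- The path `a u.reverse ab u b` ends at a point with even coordinates.
    simp only [List.nil_append, List.append_assoc, List.cons_append, pathEnd_cons, pathEnd_append,
      pathEnd_reverse, pathEnd_nil, Letter.step, Prod.ext_iff, Prod.fst_add, Prod.snd_add,
      Prod.fst_zero, Prod.snd_zero] at hw
    have := Nat.dvd_gcd (show 2 ∣ p by omega) (show 2 ∣ q by omega)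
    rw [hpq] at this
    omega

/-- Among the paths to a primitive vector, the Christoffel path has the least `m`-value. -/
lemma IsChristoffel.mValue_le (hq : 0 < q) (hpq : p.Coprime q) {v : List Letter}
    (hv : IsChristoffel p q v) (hvend : pathEnd v = (q, p)) (w : List Letter)
    (hw : pathEnd w = (q, p)) : mValue v ≤ mValue w := by
  induction hn : (mValue w).toNat using Nat.strong_induction_on generalizing w with
  | _ n ih =>
    by_cases hc : IsChristoffel p q w
    · rw [hv.eq_of_pathEnd_eq hc (hvend.trans hw.symm)]
    · obtain ⟨w', hw', hlt⟩ : ∃ w', pathEnd w' = (q, p) ∧ mValue w' < mValue w := by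
        simp only [IsChristoffel, not_forall, not_and_or, not_le, not_lt] at hc
        obtain ⟨x, y, hxy, h | h⟩ := hc
        · exact exists_mValue_lt_of_height_neg hq hpq hw ⟨x, y, hxy, h⟩
        · exact exists_mValue_lt_of_le_height hq hpq hw ⟨x, y, hxy, h⟩
      have := mValue_nonneg w'
      exact (ih _ (by omega) w' hw' rfl).trans hlt.le

end Height

/-! ### Words along the Farey tree -/

/-- The tree of Christoffel words, in which the middle word of a node is the concatenation of the
outer two; addresses are as for the Farey tree. -/
def wordTree : List Move → Fin 3 → List Letter
  | [] => ![[.a], [.a, .a, .b], [.a, .b]]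
  | .left :: s => ![wordTree s 0, wordTree s 0 ++ wordTree s 1, wordTree s 1]
  | .right :: s => ![wordTree s 1, wordTree s 1 ++ wordTree s 2, wordTree s 2]

lemma wordTree_one (s : List Move) : wordTree s 1 = wordTree s 0 ++ wordTree s 2 := by
  rcases s with _ | ⟨_ | _, s⟩ <;> simp [wordTree]

lemma fareyTree_one (s : List Move) : fareyTree s 1 = fareyTree s 0 + fareyTree s 2 := by
  rcases s with _ | ⟨_ | _, s⟩ <;> simp [fareyTree]

lemma fareyTree_unimodular (s : List Move) :
    (fareyTree s 2).1 * (fareyTree s 0).2 = (fareyTree s 0).1 * (fareyTree s 2).2 + 1 := by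
  induction s with
  | nil => simp [fareyTree]
  | cons m s ih =>
    cases m <;> simp [fareyTree, fareyTree_one] <;> linarith

lemma fareyTree_pos (s : List Move) : 0 < (fareyTree s 0).2 ∧ 0 < (fareyTree s 2).1 := by
  have h := fareyTree_unimodular s
  constructor <;> by_contra hc <;> simp at hc <;> simp [hc] at h

lemma fareyTree_snd_pos (s : List Move) (i : Fin 3) : 0 < (fareyTree s i).2 := by
  induction s generalizing i with
  | nil => fin_cases i <;> simp [fareyTree]
  | cons m s ih => cases m <;> fin_cases i <;> simp [fareyTree, ih]

lemma coprime_of_mul_eq_mul_add_one {a b c d : ℕ} (h : a * b = c * d + 1) :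
    a.Coprime d := by
  have h1 : a.gcd d ∣ c * d + 1 := h ▸ (Nat.gcd_dvd_left a d).mul_right b
  exact Nat.dvd_one.mp ((Nat.dvd_add_right ((Nat.gcd_dvd_right a d).mul_left c)).mp h1)

lemma fareyTree_coprime (s : List Move) (i : Fin 3) :
    (fareyTree s i).1.Coprime (fareyTree s i).2 := by
  have h := fareyTree_unimodular s
  have h1 := fareyTree_one s
  fin_cases i
  · exact (coprime_of_mul_eq_mul_add_one (a := (fareyTree s 0).2) (b := (fareyTree s 2).1)
      (c := (fareyTree s 2).2) (d := (fareyTree s 0).1) (by linarith)).symm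
  · refine coprime_of_mul_eq_mul_add_one (b := (fareyTree s 0).2) (c := (fareyTree s 0).1) ?_
    simp only [Fin.mk_one, h1, Prod.fst_add, Prod.snd_add]
    linarith
  · exact coprime_of_mul_eq_mul_add_one h

lemma pathEnd_wordTree (s : List Move) (i : Fin 3) :
    pathEnd (wordTree s i) = (fareyTree s i).swap := by
  induction s generalizing i with
  | nil => fin_cases i <;> simp [wordTree, fareyTree, pathEnd, Letter.step]
  | cons m s ih =>
    cases m <;> fin_cases i <;> simp [wordTree, fareyTree, pathEnd_append, ih]

/-- The concatenation of the Christoffel words of Farey neighbours is a Christoffel word. -/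
lemma IsChristoffel.append {p₁ q₁ p₂ q₂ : ℕ} {u v : List Letter}
    (hu : IsChristoffel p₁ q₁ u) (hv : IsChristoffel p₂ q₂ v)
    (hu' : pathEnd u = (q₁, p₁)) (hv' : pathEnd v = (q₂, p₂))
    (hq : 0 < q₁) (hp : 0 < p₂) (hdet : p₂ * q₁ = p₁ * q₂ + 1) :
    IsChristoffel (p₁ + p₂) (q₁ + q₂) (u ++ v) := by
  have hdet' : (p₂ : ℤ) * q₁ = p₁ * q₂ + 1 := by exact_mod_cast hdet
  have hadd : ∀ x, height (p₁ + p₂) (q₁ + q₂) x = height p₁ q₁ x + height p₂ q₂ x := by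
    intro x
    simp only [height]
    push_cast
    ring
  intro x y hxy
  rcases List.append_eq_append_iff.mp hxy with ⟨z, hz, -⟩ | ⟨z, rfl, hz⟩
  · obtain ⟨h1, h2⟩ := hu x z hz.symm
    have hx : (pathEnd x).1 ≤ q₁ := by
      have := congrArg Prod.fst (hz ▸ hu')
      rw [pathEnd_append] at this
      simp only [Prod.fst_add] at this
      omega
    have e : (q₁ : ℤ) * height p₂ q₂ x = q₂ * height p₁ q₁ x + (pathEnd x).1 := by
      simp only [height]
      linear_combination (pathEnd x).1 * hdet'
    have h3 : 0 ≤ height p₂ q₂ x := by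
      refine nonneg_of_mul_nonneg_right (a := (q₁ : ℤ)) ?_ (by exact_mod_cast hq)
      rw [e]
      positivity
    have h4 : height p₂ q₂ x < p₂ + q₂ + 1 := by
      refine lt_of_mul_lt_mul_left (a := (q₁ : ℤ)) ?_ (by positivity)
      rw [e]
      zify at hx
      nlinarith [mul_le_mul_of_nonneg_left (Int.le_sub_one_of_lt h2) (Int.natCast_nonneg q₂)]
    rw [hadd]
    push_cast
    constructor <;> omega
  · obtain ⟨h1, h2⟩ := hv z y hz.symm
    have hz2 : (pathEnd z).2 ≤ p₂ := by
      have := congrArg Prod.snd (hz ▸ hv')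
      rw [pathEnd_append] at this
      simp only [Prod.snd_add] at this
      omega
    have e : (p₂ : ℤ) * height p₁ q₁ z = p₁ * height p₂ q₂ z - (pathEnd z).2 := by
      simp only [height]
      linear_combination -(pathEnd z).2 * hdet'
    have h3 : -1 ≤ height p₁ q₁ z := by
      refine le_of_mul_le_mul_left (a := (p₂ : ℤ)) ?_ (by exact_mod_cast hp)
      rw [e]
      zify at hz2
      nlinarith [mul_nonneg (Int.natCast_nonneg p₁) h1]
    have h4 : height p₁ q₁ z < p₁ + q₁ := by
      refine lt_of_mul_lt_mul_left (a := (p₂ : ℤ)) ?_ (by positivity)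
      rw [e]
      nlinarith [mul_le_mul_of_nonneg_left (Int.le_sub_one_of_lt h2) (Int.natCast_nonneg p₁)]
    have hu1 : height (p₁ + p₂) (q₁ + q₂) u = 1 := by
      simp only [height, hu']
      push_cast
      linear_combination hdet'
    rw [height_append, hu1, hadd]
    push_cast
    constructor <;> omega

lemma isChristoffel_wordTree (s : List Move) (i : Fin 3) :
    IsChristoffel (fareyTree s i).1 (fareyTree s i).2 (wordTree s i) := by
  have mid : ∀ s, (∀ i, i ≠ 1 → IsChristoffel (fareyTree s i).1 (fareyTree s i).2 (wordTree s i)) →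
      IsChristoffel (fareyTree s 1).1 (fareyTree s 1).2 (wordTree s 1) := by
    intro s h
    rw [wordTree_one, fareyTree_one]
    exact (h 0 (by decide)).append (h 2 (by decide)) (pathEnd_wordTree s 0) (pathEnd_wordTree s 2)
      (fareyTree_pos s).1 (fareyTree_pos s).2 (fareyTree_unimodular s)
  suffices outer : ∀ s i, i ≠ 1 →
      IsChristoffel (fareyTree s i).1 (fareyTree s i).2 (wordTree s i) by
    by_cases hi : i = 1
    · exact hi ▸ mid s (outer s)
    · exact outer s i hi
  intro s
  induction s with
  | nil =>
    intro i hi x y hxy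
    fin_cases i
    · rcases x with _ | ⟨_, _ | _⟩ <;> simp [wordTree, fareyTree] at hxy ⊢
      simp [hxy.1]
    · exact absurd rfl hi
    · rcases x with _ | ⟨_, _ | ⟨_, _ | _⟩⟩ <;> simp [wordTree, fareyTree] at hxy ⊢
      · simp [hxy.1]
      · simp [hxy.1, hxy.2.1]
  | cons m s ih =>
    intro i hi
    cases m <;> fin_cases i
    · exact ih 0 (by decide)
    · exact absurd rfl hi
    · exact mid s ih
    · exact mid s ih
    · exact absurd rfl hi
    · exact ih 2 (by decide)

/-! ### Matrices along the Markov tree -/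

lemma mul_self_fin_two {M : Matrix (Fin 2) (Fin 2) ℤ} (hM : M.det = 1) :
    M * M = M.trace • M - 1 := by
  rw [Matrix.det_fin_two] at hM
  ext i j
  fin_cases i <;> fin_cases j <;>
    simp [Matrix.mul_apply, Fin.sum_univ_two, Matrix.trace_fin_two, -zsmul_eq_mul] <;> linarith

/-- The words of the tree have Markov numbers as `m`-values. The trace condition is what makes the
induction work. -/
lemma mValue_wordTree_and_trace (s : List Move) (i : Fin 3) :
    mValue (wordTree s i) = markovTree s i ∧
      (wordMatrix (wordTree s i)).trace = 3 * markovTree s i := by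
  induction s generalizing i with
  | nil =>
    fin_cases i <;> simp [wordTree, markovTree, mValue, wordMatrix, Letter.matrix,
      Matrix.trace_fin_two]
  | cons m s ih =>
    obtain ⟨h0, t0⟩ := ih 0
    obtain ⟨h1, t1⟩ := ih 1
    obtain ⟨h2, t2⟩ := ih 2
    rw [mValue_eq_wordMatrix] at h0 h1 h2
    cases m
    · have key : wordMatrix (wordTree s 0 ++ wordTree s 1) =
          (3 * markovTree s 0) • wordMatrix (wordTree s 1) - wordMatrix (wordTree s 2) := by
        rw [wordTree_one, wordMatrix_append, wordMatrix_append, ← mul_assoc,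
          mul_self_fin_two (wordMatrix_det _), t0, sub_mul, one_mul, smul_mul_assoc]
      fin_cases i
      · exact ih 0
      · simp [wordTree, markovTree, mValue_eq_wordMatrix, key, h1, h2, t1, t2, -zsmul_eq_mul]
        ring
      · exact ih 1
    · have key : wordMatrix (wordTree s 1 ++ wordTree s 2) =
          (3 * markovTree s 2) • wordMatrix (wordTree s 1) - wordMatrix (wordTree s 0) := by
        rw [wordTree_one, wordMatrix_append, wordMatrix_append, mul_assoc,
          mul_self_fin_two (wordMatrix_det _), t2, mul_sub, mul_one, mul_smul_comm]
      fin_cases i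
      · exact ih 1
      · simp [wordTree, markovTree, mValue_eq_wordMatrix, key, h0, h1, t0, t1, -zsmul_eq_mul]
        constructor <;> ring
      · exact ih 2

lemma IsMarkovNumberAt.isLeast {p q : ℕ} {k : ℤ} (h : IsMarkovNumberAt p q k) :
    IsLeast {k : ℤ | ∃ w : List Letter, pathEnd w = (q, p) ∧ mValue w = k} k := by
  obtain ⟨s, i, hf, rfl⟩ := h
  have hend := pathEnd_wordTree s i
  have hc := isChristoffel_wordTree s i
  have hq := fareyTree_snd_pos s i
  have hcop := fareyTree_coprime s i
  rw [hf] at hend hc hq hcop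
  refine ⟨⟨wordTree s i, hend, (mValue_wordTree_and_trace s i).1⟩, ?_⟩
  rintro _ ⟨w, hw, rfl⟩
  rw [← (mValue_wordTree_and_trace s i).1]
  exact hc.mValue_le hq hcop hend w hw

/-! ### Every fraction occurs in the Farey tree -/

/-- Below a node with outer fractions `a / b` and `e / f` stand all
`(x a + y e) / (x b + y f)` with `x`, `y` positive and coprime. -/
lemma exists_fareyTree_eq_smul_add_smul (x y : ℕ) (hx : 0 < x) (hy : 0 < y) (hxy : x.Coprime y)
    (s : List Move) : ∃ t, fareyTree t 1 = x • fareyTree s 0 + y • fareyTree s 2 := by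
  induction hn : x + y using Nat.strong_induction_on generalizing x y s with
  | _ n ih =>
    rcases lt_trichotomy x y with hlt | rfl | hlt
    · obtain ⟨d, rfl⟩ := Nat.exists_eq_add_of_lt hlt
      obtain ⟨t, ht⟩ := ih (x + (d + 1)) (by omega) x (d + 1) hx (by omega)
        (by simpa [add_assoc] using hxy) (.right :: s) rfl
      refine ⟨t, ht.trans ?_⟩
      simp only [fareyTree, fareyTree_one, Matrix.cons_val]
      module
    · obtain rfl : x = 1 := by simpa using hxy
      exact ⟨s, by simp [fareyTree_one]⟩
    · obtain ⟨d, rfl⟩ := Nat.exists_eq_add_of_lt hlt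
      obtain ⟨t, ht⟩ := ih (d + 1 + y) (by omega) (d + 1) y (by omega) hy
        (by simpa [add_assoc] using hxy) (.left :: s) rfl
      refine ⟨t, ht.trans ?_⟩
      simp only [fareyTree, fareyTree_one, Matrix.cons_val]
      module

lemma exists_isMarkovNumberAt {p q : ℕ} (hpq : p < q) (hcop : Nat.Coprime p q) :
    ∃ k, IsMarkovNumberAt p q k := by
  rcases Nat.eq_zero_or_pos p with rfl | hp
  · obtain rfl : q = 1 := by simpa using hcop
    exact ⟨_, [], 0, rfl, rfl⟩
  · obtain ⟨d, rfl⟩ := Nat.exists_eq_add_of_lt hpq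
    obtain ⟨t, ht⟩ := exists_fareyTree_eq_smul_add_smul (d + 1) p (by omega) hp
      (by simpa [add_assoc] using hcop.symm) []
    refine ⟨_, t, 1, ht.trans ?_, rfl⟩
    simp [fareyTree]
    ring

theorem mainTheorem3 (p q : ℕ) (hpq : p < q) (hcop : Nat.Coprime p q) :
    (∃! k : ℤ, IsMarkovNumberAt p q k) ∧
    IsLeast {k : ℤ | ∃ w : List Letter, pathEnd w = (q, p) ∧ mValue w = k}
      (markovNumber p q) := by
  have hex := exists_isMarkovNumberAt hpq hcop
  refine ⟨?_, (Classical.epsilon_spec hex).isLeast⟩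
  obtain ⟨k, hk⟩ := hex
  exact ⟨k, hk, fun k' hk' => hk'.isLeast.unique hk.isLeast⟩
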